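/- Let $d\in\mathbb N$, let $U\subset\mathbb R^2$ be an open neighbourhood of the origin, let $a_1,\dots,a_d:U\to\mathbb R$ be real analytic functions, and put $$P(x,y,z)=z^d+\sum_{i=1}^d a_i(x,y)\,z^{d-i}.$$ Assume that $P$ is hyperbolic with respect to $z$, that is, for each $(x,y)\in U$ the polynomial $z\mapsto P(x,y,z)$ has only real roots (every complex root is real). For $N\in\mathbb N$ and $\delta>0$ let $$H_{N,\delta}=\{(x,y)\in\mathbb R^2:\ |x|<y^N,\ 0<y<\delta\}.$$ Then for $N$ large enough and $\delta$ small enough $P$ splits analytically on $H_{N,\delta}$. Precisely, there exist $N_0\in\mathbb N$ and $\delta_0>0$ such that for every integer $N\ge N_0$ and every $0<\delta\le\delta_0$ one has $H_{N,\delta}\subset U$, and there are real analytic functions $f_1,\dots,f_d:H_{N,\delta}\to\mathbb R$ with $$P(x,y,z)=\prod_{i=1}^d\bigl(z-f_i(x,y)\bigr)\qquad\text{for all }(x,y)\in H_{N,\delta},\ z\in\mathbb R.$$ -/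

import Mathlib

open Polynomial

/-- The monic polynomial `z ^ d + a₁ z ^ (d - 1) + ⋯ + a_d` whose coefficients are evaluated at
the point `p = (x, y)`. The entry `a i` with `i : Fin d` is the coefficient `a_{i + 1}`. -/
noncomputable def monicFamily {d : ℕ} (a : Fin d → ℝ × ℝ → ℝ) (p : ℝ × ℝ) : ℝ[X] :=
  X ^ d + ∑ i : Fin d, C (a i p) * X ^ (d - ((i : ℕ) + 1))

/-- A real polynomial is hyperbolic if all its complex roots are real. -/
def IsHyperbolic (Q : ℝ[X]) : Prop :=
  ∀ z : ℂ, aeval z Q = 0 → z.im = 0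

/-- The horn region `{(x, y) : |x| < y ^ N, 0 < y < δ}`. -/
def hornRegion (N : ℕ) (δ : ℝ) : Set (ℝ × ℝ) :=
  {p | |p.1| < p.2 ^ N ∧ 0 < p.2 ∧ p.2 < δ}

/-! Substituting `x = y ^ M * u` turns the horn into a region in the `(u, y)` plane that shrinks to
the origin, so it is enough that the pulled-back family has analytic roots near the origin for some
`M` (`IsAnalyticFamily.splitsAfterBlow`).

The proof is by strong induction on the degree `d`. A Tschirnhaus shift makes the roots sum to zero.
A further substitution makes every coefficient zero or a monomial times a unit
(`AnalyticAt.exists_isMonomialGerm_blow`). For real roots with sum zero, the coefficient of `z ^ (d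
- 2)` is minus half the sum of their squares. If it vanishes, so do all roots. Otherwise its
monomial is a square `w ^ 2`, all roots are `O(w)`, and the coefficient of `z ^ i` is divisible by
`w ^ (d - i)`. Dividing the roots by `w` gives an analytic family
(`IsAnalyticFamily.exists_eq_scaleRoots`) which at the origin is centered, real-rooted and different
from `z ^ d`, hence has two distinct roots. Hensel's lemma (`IsAnalyticFamily.exists_mul_eq`) splits
it into families of smaller degree.

Dividing by `w` is possible only where `w ≠ 0`, so real-rootedness is carried through the induction
off the axes only. -/

open Filter Topology

/-! ### Root and coefficient bounds for real-rooted polynomials. -/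

/-- A hyperbolic polynomial splits over `ℝ`. -/
theorem IsHyperbolic.splits {Q : ℝ[X]} (hQ : IsHyperbolic Q) : Q.Splits := by
  refine Splits.of_splits_map (algebraMap ℝ ℂ) (IsAlgClosed.splits _) fun z hz => ?_
  have h1 : aeval z Q = 0 := by
    have := (mem_roots'.1 hz).2
    rwa [IsRoot.def, eval_map_algebraMap] at this
  exact ⟨z.re, Complex.ext (by simp) (by simp [hQ z h1])⟩

/-- A monic real-rooted polynomial of degree `n` has modulus at least `|Im z| ^ n` at `z`. -/
theorem Polynomial.Splits.abs_im_pow_le_norm_aeval {Q : ℝ[X]} (hQ : Q.Splits) (hm : Q.Monic)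
    (z : ℂ) : |z.im| ^ Q.natDegree ≤ ‖aeval z Q‖ := by
  have key : ∀ s : Multiset ℝ, |z.im| ^ s.card ≤ ‖aeval z (s.map (X - C ·)).prod‖ := by
    intro s
    induction s using Multiset.induction_on with
    | empty => simp
    | cons r s ih =>
      rw [Multiset.map_cons, Multiset.prod_cons, map_mul, norm_mul, Multiset.card_cons, pow_succ']
      gcongr
      have := Complex.abs_im_le_norm (z - r)
      simpa using this
  have := key Q.roots
  rwa [← hQ.eq_prod_roots_of_monic hm, ← hQ.natDegree_eq_card_roots] at this

theorem Multiset.sum_sq_eq_sum_map_sq_add_esymm_two (s : Multiset ℝ) :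
    s.sum ^ 2 = (s.map (· ^ 2)).sum + 2 * s.esymm 2 := by
  induction s using Multiset.induction_on with
  | empty => simp [Multiset.esymm, Multiset.powersetCard_zero_right]
  | cons r s ih =>
    have h : (r ::ₘ s).esymm 2 = s.esymm 2 + r * s.sum := by
      simp [Multiset.esymm, Multiset.powersetCard_cons, Multiset.powersetCard_one,
        Multiset.map_map]
      simpa using Multiset.sum_map_mul_left (a := r) (f := fun x => x) (s := s)
    simp only [Multiset.sum_cons, Multiset.map_cons, h]
    linear_combination ih

/-- The squared roots of a centered real-rooted polynomial are bounded by minus twice its second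
coefficient. -/
theorem Polynomial.Splits.sq_root_le {Q : ℝ[X]} {n : ℕ} (hQ : Q.Splits) (hm : Q.Monic)
    (hd : Q.natDegree = n + 2) (hc : Q.coeff (n + 1) = 0) :
    0 ≤ -Q.coeff n ∧ ∀ r ∈ Q.roots, r ^ 2 ≤ -2 * Q.coeff n := by
  have h1 := coeff_eq_esymm_roots_of_splits hQ (k := n + 1) (by omega)
  have h2 := coeff_eq_esymm_roots_of_splits hQ (k := n) (by omega)
  rw [hd, hm.leadingCoeff] at h1 h2
  rw [show n + 2 - (n + 1) = 1 by omega, hc] at h1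
  rw [show n + 2 - n = 2 by omega] at h2
  have h1' : Q.roots.sum = 0 := by
    simpa [Multiset.esymm, Multiset.powersetCard_one, Multiset.map_map, Function.comp_def]
      using h1.symm
  have h3 := Q.roots.sum_sq_eq_sum_map_sq_add_esymm_two
  have h4 : (Q.roots.map (· ^ 2)).sum = -2 * Q.coeff n := by
    rw [h1'] at h3; rw [h2]; linear_combination -h3
  have h5 : ∀ x ∈ Q.roots.map (· ^ 2), (0 : ℝ) ≤ x := by
    intro x hx
    obtain ⟨r, -, rfl⟩ := Multiset.mem_map.1 hx
    positivity
  refine ⟨?_, fun r hr => ?_⟩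
  · have := Multiset.sum_nonneg h5
    linarith
  · rw [← h4]
    exact Multiset.single_le_sum h5 _ (Multiset.mem_map_of_mem _ hr)

/-- All roots have modulus at most `√(-2 * Q.coeff n)`, so Vieta's formulas bound each coefficient.
-/
theorem Polynomial.Splits.abs_coeff_le {Q : ℝ[X]} {n : ℕ} (hQ : Q.Splits) (hm : Q.Monic)
    (hd : Q.natDegree = n + 2) (hc : Q.coeff (n + 1) = 0) (i : ℕ) :
    |Q.coeff i| ≤ √(-2 * Q.coeff n) ^ (n + 2 - i) * (n + 2).choose i := by
  have := coeff_le_of_roots_le (p := Q) (f := RingHom.id ℝ) (B := √(-2 * Q.coeff n)) i hm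
    (by simpa using hQ) (fun z hz => by
      rw [Polynomial.map_id] at hz
      exact Real.abs_le_sqrt ((hQ.sq_root_le hm hd hc).2 z hz))
  simpa [hd] using this

/-! ### Division of power series and Hadamard's lemma. -/

section Division
variable {E : Type*} [NormedAddCommGroup E] [NormedSpace ℝ E]

/-- The power series obtained by dividing `v ↦ f v - f (v - ℓ v • e)` by `ℓ`, where `f` is the sum
of the power series `p`. -/
noncomputable def FormalMultilinearSeries.divLinear (p : FormalMultilinearSeries ℝ E ℝ)
    (ℓ : E →L[ℝ] ℝ) (e : E) : FormalMultilinearSeries ℝ E ℝ := fun n =>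
  ∑ i : Fin (n + 1), ((p (n + 1)).curryMid i e).compContinuousLinearMap
    fun j => if i.succAbove j < i then ContinuousLinearMap.id ℝ E
      else ContinuousLinearMap.id ℝ E - ℓ.smulRight e

/-- Telescoping: the arguments are changed from `v` to `v - ℓ v • e` one slot at a time. Each
difference has `ℓ v • e` in the changed slot, and the scalar `ℓ v` comes out by linearity. -/
theorem FormalMultilinearSeries.sub_eq_mul_divLinear (p : FormalMultilinearSeries ℝ E ℝ)
    (ℓ : E →L[ℝ] ℝ) (e : E) (n : ℕ) (v : E) :
    p (n + 1) (fun _ => v) - p (n + 1) (fun _ => v - ℓ v • e)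
      = ℓ v * p.divLinear ℓ e n (fun _ => v) := by
  have h := (p (n + 1)).toMultilinearMap.map_sub_map_piecewise (fun _ => v)
    (fun _ => v - ℓ v • e) Finset.univ
  rw [Finset.piecewise_univ] at h
  simp only [ContinuousMultilinearMap.coe_coe, Finset.mem_univ, true_implies] at h
  rw [h, divLinear, sum_apply, Finset.mul_sum]
  refine Finset.sum_congr rfl fun i _ => ?_
  rw [ContinuousMultilinearMap.compContinuousLinearMap_apply,
    ContinuousMultilinearMap.curryMid_apply, ← smul_eq_mul]
  set m : Fin (n + 1) → E := i.insertNth e fun j => (if i.succAbove j < i then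
    ContinuousLinearMap.id ℝ E else ContinuousLinearMap.id ℝ E - ℓ.smulRight e) v with hm
  have h1 : m = Function.update m i e := by
    rw [eq_comm, Function.update_eq_self_iff, hm, Fin.insertNth_apply_same]
  rw [h1, ← ContinuousMultilinearMap.map_update_smul]
  congr 1
  ext j
  rcases eq_or_ne j i with rfl | hj
  · simp
  · obtain ⟨k, rfl⟩ := Fin.exists_succAbove_eq hj
    rw [Function.update_of_ne hj, hm, Fin.insertNth_apply_succAbove, if_neg hj.symm]
    split_ifs <;> simp

theorem FormalMultilinearSeries.divLinear_radius_pos (p : FormalMultilinearSeries ℝ E ℝ)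
    (hp : 0 < p.radius) (ℓ : E →L[ℝ] ℝ) (e : E) : 0 < (p.divLinear ℓ e).radius := by
  obtain ⟨C, r, hC, hr, hb⟩ := p.le_mul_pow_of_radius_pos hp
  set K : ℝ := max 1 ‖ContinuousLinearMap.id ℝ E - ℓ.smulRight e‖ with hK
  have hK1 : 1 ≤ K := le_max_left _ _
  have hbound : ∀ n, ‖p.divLinear ℓ e n‖ ≤ (2 * C * r * ‖e‖) * (2 * r * K) ^ n := by
    intro n
    have h1 : ∀ i : Fin (n + 1), ‖((p (n + 1)).curryMid i e).compContinuousLinearMap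
        fun j => if i.succAbove j < i then ContinuousLinearMap.id ℝ E
          else ContinuousLinearMap.id ℝ E - ℓ.smulRight e‖ ≤ C * r ^ (n + 1) * ‖e‖ * K ^ n := by
      intro i
      refine (ContinuousMultilinearMap.norm_compContinuousLinearMap_le _ _).trans ?_
      have h2 : ‖(p (n + 1)).curryMid i e‖ ≤ C * r ^ (n + 1) * ‖e‖ := by
        refine (ContinuousLinearMap.le_opNorm _ _).trans ?_
        rw [ContinuousMultilinearMap.norm_curryMid]
        gcongr
        exact hb _
      refine mul_le_mul h2 ?_ (by positivity) (by positivity)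
      refine (Finset.prod_le_prod (g := fun _ => K) (fun _ _ => norm_nonneg _)
        fun j _ => ?_).trans (by simp)
      split_ifs
      · exact ContinuousLinearMap.norm_id_le.trans hK1
      · exact le_max_right _ _
    refine (norm_sum_le _ _).trans ((Finset.sum_le_card_nsmul _ _ _ fun i _ => h1 i).trans ?_)
    -- The number of summands is absorbed into the geometric rate, whence the `2` in `2 * r * K`.
    have h3 : ((n + 1 : ℕ) : ℝ) ≤ 2 ^ (n + 1) := by
      exact_mod_cast (Nat.lt_two_pow_self (n := n + 1)).le
    rw [Finset.card_univ, Fintype.card_fin, nsmul_eq_mul]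
    calc _ ≤ (2 : ℝ) ^ (n + 1) * (C * r ^ (n + 1) * ‖e‖ * K ^ n) := by gcongr
      _ = _ := by rw [mul_pow, mul_pow]; ring
  have hpos : 0 < 2 * r * K := by positivity
  refine lt_of_lt_of_le ?_ ((p.divLinear ℓ e).le_radius_of_bound (2 * C * r * ‖e‖)
    (r := NNReal.mk (2 * r * K)⁻¹ (inv_pos.2 hpos).le) fun n => ?_)
  · rw [ENNReal.coe_pos, ← NNReal.coe_pos]
    exact inv_pos.2 hpos
  · refine (mul_le_mul_of_nonneg_right (hbound n) (by positivity)).trans (le_of_eq ?_)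
    rw [NNReal.coe_mk, mul_assoc, ← mul_pow, mul_inv_cancel₀ hpos.ne', one_pow, mul_one]

/-- Hadamard's lemma for real analytic functions. -/
theorem AnalyticAt.exists_sub_eq_mul {f : E → ℝ} (hf : AnalyticAt ℝ f 0) (ℓ : E →L[ℝ] ℝ) (e : E) :
    ∃ g : E → ℝ, AnalyticAt ℝ g 0 ∧ ∀ᶠ v in 𝓝 0, f v - f (v - ℓ v • e) = ℓ v * g v := by
  obtain ⟨p, r, hp⟩ := hf
  have hq := (p.divLinear ℓ e).hasFPowerSeriesOnBall (p.divLinear_radius_pos hp.radius_pos ℓ e)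
  refine ⟨_, hq.analyticAt, ?_⟩
  have hL : Continuous fun v : E => v - ℓ v • e := by fun_prop
  have hb := Metric.eball_mem_nhds (0 : E) hp.r_pos
  filter_upwards [hb, hL.continuousAt.preimage_mem_nhds (by simpa using hb),
    Metric.eball_mem_nhds (0 : E) hq.r_pos] with v hv hLv hqv
  have h1 := (hp.hasSum hv).sub (hp.hasSum hLv)
  have h2 := (hasSum_nat_add_iff' 1).2 h1
  have h3 := (hq.hasSum hqv).mul_left (ℓ v)
  simp only [zero_add, p.sub_eq_mul_divLinear] at h2 h3
  refine Eq.trans ?_ (h2.unique h3)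
  have : p 0 (fun _ => v) = p 0 (fun _ => v - ℓ v • e) := congrArg _ (Subsingleton.elim _ _)
  simp [this]

end Division

/-! ### The substitution `blow` and monomialization of germs. -/

/-- The map `(u, y) ↦ (y ^ N u, y)`. -/
def blow (N : ℕ) (v : ℝ × ℝ) : ℝ × ℝ := (v.2 ^ N * v.1, v.2)

@[simp] theorem blow_zero_right (N : ℕ) : blow N 0 = 0 := by simp [blow]

theorem blow_blow (M N : ℕ) (v : ℝ × ℝ) : blow M (blow N v) = blow (M + N) v := by
  simp [blow, pow_add, mul_assoc]

theorem analyticAt_blow (N : ℕ) (v : ℝ × ℝ) : AnalyticAt ℝ (blow N) v :=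
  ((analyticAt_snd.pow N).mul analyticAt_fst).prod analyticAt_snd

theorem tendsto_blow (N : ℕ) : Tendsto (blow N) (𝓝 0) (𝓝 0) := by
  simpa using (analyticAt_blow N 0).continuousAt.tendsto

theorem AnalyticAt.comp_blow {f : ℝ × ℝ → ℝ} (hf : AnalyticAt ℝ f 0) (N : ℕ) :
    AnalyticAt ℝ (fun v => f (blow N v)) 0 :=
  AnalyticAt.fun_comp (by simpa using hf) (analyticAt_blow N 0)

/-- A germ at the origin of the plane that vanishes or is a monomial times a unit. -/
def IsMonomialGerm (f : ℝ × ℝ → ℝ) : Prop :=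
  (∀ᶠ v in 𝓝 0, f v = 0) ∨ ∃ (k l : ℕ) (g : ℝ × ℝ → ℝ), AnalyticAt ℝ g 0 ∧ g 0 ≠ 0 ∧
    ∀ᶠ v in 𝓝 0, f v = v.1 ^ k * v.2 ^ l * g v

/-- A nonvanishing analytic germ has finite order along some line. -/
theorem AnalyticAt.exists_analyticOrderAt_line_ne_top {E : Type*} [NormedAddCommGroup E]
    [NormedSpace ℝ E] {f : E → ℝ} (hf : AnalyticAt ℝ f 0) (h : ¬∀ᶠ v in 𝓝 0, f v = 0) :
    ∃ w : E, analyticOrderAt (fun t : ℝ => f (t • w)) 0 ≠ ⊤ := by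
  obtain ⟨ε, hε, hb⟩ := Metric.eventually_nhds_iff_ball.1 hf.eventually_analyticAt
  by_contra! H
  refine h ?_
  filter_upwards [Metric.ball_mem_nhds (0 : E) hε] with w hw
  have hseg : ∀ t ∈ Set.Icc (0 : ℝ) 1, t • w ∈ Metric.ball (0 : E) ε := by
    intro t ht
    rw [mem_ball_zero_iff] at hw ⊢
    rw [norm_smul, Real.norm_of_nonneg ht.1]
    exact (mul_le_of_le_one_left (norm_nonneg _) ht.2).trans_lt hw
  have hA : AnalyticOnNhd ℝ (fun t : ℝ => f (t • w)) (Set.Icc 0 1) := fun t ht =>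
    AnalyticAt.fun_comp (hb _ (hseg t ht)) (by fun_prop)
  have h0 := analyticOrderAt_eq_top.1 (H w)
  -- The identity theorem carries the vanishing from `t = 0` to `t = 1`, where the value is `f w`.
  have := hA.eqOn_zero_of_preconnected_of_eventuallyEq_zero isPreconnected_Icc
    (Set.left_mem_Icc.2 zero_le_one) h0 (Set.right_mem_Icc.2 zero_le_one)
  simpa using this

theorem AnalyticAt.exists_eq_fst_mul {f : ℝ × ℝ → ℝ} (hf : AnalyticAt ℝ f 0) :
    ∃ g, AnalyticAt ℝ g 0 ∧ ∀ᶠ v in 𝓝 0, f v = f (0, v.2) + v.1 * g v := by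
  obtain ⟨g, hg, h⟩ := hf.exists_sub_eq_mul (ContinuousLinearMap.fst ℝ ℝ ℝ) (1, 0)
  refine ⟨g, hg, h.mono fun v hv => ?_⟩
  have : v - v.1 • ((1, 0) : ℝ × ℝ) = (0, v.2) := by ext <;> simp
  rw [ContinuousLinearMap.coe_fst', this] at hv
  linarith

theorem tendsto_zero_prod_snd : Tendsto (fun v : ℝ × ℝ => v.2) (𝓝 0) (𝓝 0) :=
  continuous_snd.tendsto' _ _ rfl

/-- A nonvanishing analytic germ is a power of the first variable times a germ which does not vanish
identically on the second axis. -/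
theorem AnalyticAt.exists_eq_fst_pow_mul {f : ℝ × ℝ → ℝ} (hf : AnalyticAt ℝ f 0)
    (h : ¬∀ᶠ v in 𝓝 0, f v = 0) :
    ∃ (k : ℕ) (g : ℝ × ℝ → ℝ), AnalyticAt ℝ g 0 ∧ (¬∀ᶠ t in 𝓝 (0 : ℝ), g (0, t) = 0) ∧
      ∀ᶠ v in 𝓝 0, f v = v.1 ^ k * g v := by
  obtain ⟨w, hw⟩ := hf.exists_analyticOrderAt_line_ne_top h
  obtain ⟨m, hm⟩ := ENat.ne_top_iff_exists.1 hw
  -- An inequality suffices for the induction: dividing by the first coordinate lowers the order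
  -- along the line by at least one.
  replace hm := hm.symm.le
  clear h hw
  induction m generalizing f with
  | zero =>
    refine ⟨0, f, hf, fun h0 => ?_, by simp⟩
    have hA : AnalyticAt ℝ (fun t : ℝ => f (t • w)) 0 :=
      AnalyticAt.fun_comp (by simpa using hf) (by fun_prop)
    have h1 := hA.analyticOrderAt_eq_zero.1 (by simpa using hm)
    exact h1 (by rw [zero_smul]; exact h0.self_of_nhds)
  | succ m ih =>
    by_cases h0 : ∀ᶠ t in 𝓝 (0 : ℝ), f (0, t) = 0
    · obtain ⟨g, hg, hfg⟩ := hf.exists_eq_fst_mul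
      have hfg' : ∀ᶠ v in 𝓝 0, f v = v.1 * g v := by
        filter_upwards [hfg, tendsto_zero_prod_snd.eventually h0] with v h1 h2
        rw [h1, h2, zero_add]
      have hline : Tendsto (fun t : ℝ => t • w) (𝓝 0) (𝓝 0) :=
        Continuous.tendsto' (by fun_prop) _ _ (by simp)
      have hA1 : AnalyticAt ℝ (fun t : ℝ => (t • w).1) 0 := by fun_prop
      have hA2 : AnalyticAt ℝ (fun t : ℝ => g (t • w)) 0 :=
        AnalyticAt.fun_comp (by simpa using hg) (by fun_prop)
      have h1 : analyticOrderAt (fun t : ℝ => f (t • w)) 0 =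
          analyticOrderAt (fun t : ℝ => (t • w).1) 0
            + analyticOrderAt (fun t : ℝ => g (t • w)) 0 := by
        rw [← analyticOrderAt_mul hA1 hA2]
        exact analyticOrderAt_congr (hline.eventually hfg')
      have h2 : 1 ≤ analyticOrderAt (fun t : ℝ => (t • w).1) 0 := by
        rw [Order.one_le_iff_ne_zero, Ne, hA1.analyticOrderAt_eq_zero]
        simp
      have h3 : analyticOrderAt (fun t : ℝ => g (t • w)) 0 ≤ m := by
        rw [h1, Nat.cast_succ, add_comm (m : ℕ∞)] at hm
        exact (ENat.add_le_add_iff_left ENat.one_ne_top).1 ((add_le_add_left h2 _).trans hm)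
      obtain ⟨k, g', hg', hne, hev⟩ := ih hg h3
      refine ⟨k + 1, g', hg', hne, ?_⟩
      filter_upwards [hfg', hev] with v h1 h2
      rw [h1, h2]; ring
    · exact ⟨0, f, hf, h0, by simp⟩

/-- The germ of an analytic function becomes a monomial times a unit after `blow N` with `N`
large. -/
theorem AnalyticAt.exists_isMonomialGerm_blow {f : ℝ × ℝ → ℝ} (hf : AnalyticAt ℝ f 0) :
    ∃ N₀, ∀ N ≥ N₀, IsMonomialGerm fun v => f (blow N v) := by
  by_cases h : ∀ᶠ v in 𝓝 0, f v = 0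
  · exact ⟨0, fun N _ => .inl ((tendsto_blow N).eventually h)⟩
  obtain ⟨k, g, hg, hne, hfg⟩ := hf.exists_eq_fst_pow_mul h
  have hA : AnalyticAt ℝ (fun t : ℝ => g (0, t)) 0 :=
    AnalyticAt.fun_comp (f := fun t : ℝ => ((0, t) : ℝ × ℝ)) hg (by fun_prop)
  obtain ⟨l, c, hc, hc0, hgc⟩ := hA.exists_eventuallyEq_pow_smul_nonzero_iff.2 hne
  obtain ⟨q, hq, hgq⟩ := hg.exists_eq_fst_mul
  -- With `g (0, y) = y ^ l * c y` and `g = g (0, y) + x * q`, putting `x = y ^ N * u` with `N ≥ l`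
  -- lets `y ^ l` factor out. The cofactor equals `c 0 ≠ 0` at the origin.
  refine ⟨l, fun N hN => .inr ⟨k, N * k + l,
    fun v => c v.2 + v.2 ^ (N - l) * v.1 * q (blow N v), ?_, by simpa using hc0, ?_⟩⟩
  · have h1 : AnalyticAt ℝ (fun v : ℝ × ℝ => c v.2) 0 :=
      AnalyticAt.fun_comp (by simpa using hc) analyticAt_snd
    exact h1.add (((analyticAt_snd.pow _).mul analyticAt_fst).mul (hq.comp_blow N))
  · filter_upwards [(tendsto_blow N).eventually hfg, (tendsto_blow N).eventually hgq,
      tendsto_zero_prod_snd.eventually hgc] with v h1 h2 h3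
    rw [h1, h2]
    simp only [blow, sub_zero, smul_eq_mul] at h3 ⊢
    rw [h3]
    obtain ⟨M, rfl⟩ := Nat.exists_eq_add_of_le hN
    simp only [Nat.add_sub_cancel_left]
    ring

/-! ### Coordinates on monic polynomials and Hensel's lemma. -/

/-- The polynomial of degree less than `n` with given coefficients. -/
noncomputable def polyOfCoeffs (n : ℕ) : (Fin n → ℝ) →ₗ[ℝ] ℝ[X] :=
  (degreeLT ℝ n).subtype ∘ₗ (degreeLTEquiv ℝ n).symm.toLinearMap

theorem degree_polyOfCoeffs_lt {n : ℕ} (c : Fin n → ℝ) : (polyOfCoeffs n c).degree < n :=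
  mem_degreeLT.1 ((degreeLTEquiv ℝ n).symm c).2

theorem polyOfCoeffs_injective (n : ℕ) : Function.Injective (polyOfCoeffs n) :=
  Subtype.val_injective.comp (degreeLTEquiv ℝ n).symm.injective

theorem polyOfCoeffs_coeff {n : ℕ} {p : ℝ[X]} (hp : p.degree < n) :
    polyOfCoeffs n (fun i : Fin n => p.coeff i) = p := by
  have : (degreeLTEquiv ℝ n) ⟨p, mem_degreeLT.2 hp⟩ = fun i : Fin n => p.coeff i := rfl
  simp [polyOfCoeffs, ← this]

/-- The monic polynomial of degree `n` with given lower coefficients. -/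
noncomputable def monicOfCoeffs (n : ℕ) (c : Fin n → ℝ) : ℝ[X] := X ^ n + polyOfCoeffs n c

theorem monic_monicOfCoeffs {n : ℕ} (c : Fin n → ℝ) : (monicOfCoeffs n c).Monic :=
  monic_X_pow_add (degree_polyOfCoeffs_lt c)

theorem natDegree_monicOfCoeffs {n : ℕ} (c : Fin n → ℝ) : (monicOfCoeffs n c).natDegree = n := by
  have := degree_polyOfCoeffs_lt c
  rw [monicOfCoeffs, natDegree_eq_of_degree_eq_some]
  rw [degree_add_eq_left_of_degree_lt] <;> simp [this]

theorem monicOfCoeffs_coeff {n : ℕ} {p : ℝ[X]} (hp : p.Monic) (hn : p.natDegree = n) :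
    monicOfCoeffs n (fun i : Fin n => p.coeff i) = p := by
  have hlt : (p - X ^ n).degree < (n : WithBot ℕ) := by
    have hd : p.degree = n := by rw [degree_eq_natDegree hp.ne_zero, hn]
    rw [← hd]
    exact degree_sub_lt_left (by simp [hd]) hp.ne_zero (by simp [hp.leadingCoeff])
  have h1 : (fun i : Fin n => p.coeff i) = fun i : Fin n => (p - X ^ n).coeff i := by
    ext i; simp [coeff_X_pow, i.2.ne]
  rw [monicOfCoeffs, h1, polyOfCoeffs_coeff hlt]; ring

/-- The coefficients of a polynomial of degree less than `n`, as continuous linear functionals. -/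
noncomputable def coeffCLM (n j : ℕ) : (Fin n → ℝ) →L[ℝ] ℝ :=
  (lcoeff ℝ j ∘ₗ polyOfCoeffs n).toContinuousLinearMap

theorem coeffCLM_apply (n j : ℕ) (c : Fin n → ℝ) : coeffCLM n j c = (polyOfCoeffs n c).coeff j :=
  rfl

theorem coeff_monicOfCoeffs (n j : ℕ) (c : Fin n → ℝ) :
    (monicOfCoeffs n c).coeff j = (X ^ n : ℝ[X]).coeff j + coeffCLM n j c := by
  simp [monicOfCoeffs, coeffCLM_apply]

theorem analyticAt_coeff_monicOfCoeffs (n j : ℕ) (c : Fin n → ℝ) :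
    AnalyticAt ℝ (fun c => (monicOfCoeffs n c).coeff j) c := by
  simp only [coeff_monicOfCoeffs]
  exact analyticAt_const.add ((coeffCLM n j).analyticAt c)

theorem hasFDerivAt_coeff_monicOfCoeffs (n j : ℕ) (c : Fin n → ℝ) :
    HasFDerivAt (fun c => (monicOfCoeffs n c).coeff j) (coeffCLM n j) c := by
  simp only [coeff_monicOfCoeffs]
  exact (coeffCLM n j).hasFDerivAt.const_add _

/-- Multiplication of monic polynomials of degrees `m` and `n`, in coordinates. -/
noncomputable def mulCoeffs (m n : ℕ) (c : (Fin m → ℝ) × (Fin n → ℝ)) : Fin (m + n) → ℝ :=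
  fun k => (monicOfCoeffs m c.1 * monicOfCoeffs n c.2).coeff k

theorem analyticAt_mulCoeffs (m n : ℕ) (c : (Fin m → ℝ) × (Fin n → ℝ)) :
    AnalyticAt ℝ (mulCoeffs m n) c := by
  rw [analyticAt_pi_iff]
  intro k
  simp only [mulCoeffs, coeff_mul]
  refine Finset.analyticAt_fun_sum _ fun x _ => ?_
  exact ((analyticAt_coeff_monicOfCoeffs m x.1 c.1).fun_comp analyticAt_fst).mul
    ((analyticAt_coeff_monicOfCoeffs n x.2 c.2).fun_comp analyticAt_snd)

/-- The derivative of `mulCoeffs`. -/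
noncomputable def mulCoeffsDeriv (m n : ℕ) (c : (Fin m → ℝ) × (Fin n → ℝ)) :
    ((Fin m → ℝ) × (Fin n → ℝ)) →L[ℝ] (Fin (m + n) → ℝ) :=
  ContinuousLinearMap.pi fun k => ∑ x ∈ Finset.HasAntidiagonal.antidiagonal (k : ℕ),
    ((monicOfCoeffs m c.1).coeff x.1 • (coeffCLM n x.2).comp (ContinuousLinearMap.snd ℝ _ _)
    + (monicOfCoeffs n c.2).coeff x.2 • (coeffCLM m x.1).comp (ContinuousLinearMap.fst ℝ _ _))

theorem mulCoeffsDeriv_apply (m n : ℕ) (c h : (Fin m → ℝ) × (Fin n → ℝ)) (k : Fin (m + n)) :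
    mulCoeffsDeriv m n c h k = (monicOfCoeffs m c.1 * polyOfCoeffs n h.2
      + polyOfCoeffs m h.1 * monicOfCoeffs n c.2).coeff k := by
  rw [coeff_add, coeff_mul, coeff_mul, ← Finset.sum_add_distrib]
  simp only [mulCoeffsDeriv, ContinuousLinearMap.pi_apply, sum_apply]
  refine Finset.sum_congr rfl fun x _ => ?_
  simp [coeffCLM_apply, mul_comm]

theorem hasFDerivAt_mulCoeffs (m n : ℕ) (c : (Fin m → ℝ) × (Fin n → ℝ)) :
    HasFDerivAt (mulCoeffs m n) (mulCoeffsDeriv m n c) c := by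
  rw [hasFDerivAt_pi']
  intro k
  simp only [mulCoeffs, coeff_mul]
  refine (HasFDerivAt.fun_sum fun x _ =>
    ((hasFDerivAt_coeff_monicOfCoeffs m x.1 c.1).comp c hasFDerivAt_fst).mul
    ((hasFDerivAt_coeff_monicOfCoeffs n x.2 c.2).comp c hasFDerivAt_snd)).congr_fderiv ?_
  ext h <;> simp [mulCoeffsDeriv]

/-- A kernel element gives `q₁ * h₂ + h₁ * q₂ = 0`. By coprimality `q₁` divides `h₁`, which has
smaller degree, so `h₁ = 0` and then `h₂ = 0`. -/
theorem mulCoeffsDeriv_injective {m n : ℕ} {c : (Fin m → ℝ) × (Fin n → ℝ)}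
    (hc : IsCoprime (monicOfCoeffs m c.1) (monicOfCoeffs n c.2)) :
    Function.Injective (mulCoeffsDeriv m n c) := by
  rw [injective_iff_map_eq_zero]
  rintro ⟨h₁, h₂⟩ h
  have hd : ∀ {n : ℕ} (c : Fin n → ℝ), (monicOfCoeffs n c).degree = n := fun c => by
    rw [degree_eq_natDegree (monic_monicOfCoeffs c).ne_zero, natDegree_monicOfCoeffs]
  have hz : monicOfCoeffs m c.1 * polyOfCoeffs n h₂ + polyOfCoeffs m h₁ * monicOfCoeffs n c.2
      = 0 := by
    have hdeg : (monicOfCoeffs m c.1 * polyOfCoeffs n h₂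
        + polyOfCoeffs m h₁ * monicOfCoeffs n c.2).degree < (m + n : ℕ) := by
      refine (degree_add_le _ _).trans_lt (max_lt ?_ ?_)
      · rw [degree_mul, hd, Nat.cast_add]
        exact WithBot.add_lt_add_left (WithBot.natCast_ne_bot _) (degree_polyOfCoeffs_lt h₂)
      · rw [degree_mul, hd, Nat.cast_add]
        exact WithBot.add_lt_add_right (WithBot.natCast_ne_bot _) (degree_polyOfCoeffs_lt h₁)
    ext k
    by_cases hk : k < m + n
    · simpa [mulCoeffsDeriv_apply] using congrFun h ⟨k, hk⟩
    · rw [coeff_zero]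
      exact coeff_eq_zero_of_degree_lt (hdeg.trans_le (by exact_mod_cast not_lt.1 hk))
  have h1 : polyOfCoeffs m h₁ = 0 := by
    refine eq_zero_of_dvd_of_degree_lt (hc.dvd_of_dvd_mul_right (y := polyOfCoeffs m h₁)
      ⟨-polyOfCoeffs n h₂, by linear_combination hz⟩) ?_
    rw [hd]
    exact degree_polyOfCoeffs_lt h₁
  rw [h1, zero_mul, add_zero] at hz
  have h2 := (mul_eq_zero.1 hz).resolve_left (monic_monicOfCoeffs c.1).ne_zero
  exact Prod.ext (polyOfCoeffs_injective m (by simpa using h1))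
    (polyOfCoeffs_injective n (by simpa using h2))

/-- A family of monic polynomials of degree `d` whose coefficients are analytic at the origin. -/
structure IsAnalyticFamily {E : Type*} [NormedAddCommGroup E] [NormedSpace ℝ E] (P : E → ℝ[X])
    (d : ℕ) : Prop where
  monic : ∀ v, (P v).Monic
  natDegree_eq : ∀ v, (P v).natDegree = d
  analyticAt_coeff : ∀ i, AnalyticAt ℝ (fun v => (P v).coeff i) 0

theorem isAnalyticFamily_monicOfCoeffs {E : Type*} [NormedAddCommGroup E] [NormedSpace ℝ E]
    {n : ℕ} {c : E → Fin n → ℝ} (hc : AnalyticAt ℝ c 0) :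
    IsAnalyticFamily (fun v => monicOfCoeffs n (c v)) n :=
  ⟨fun _ => monic_monicOfCoeffs _, fun _ => natDegree_monicOfCoeffs _, fun i =>
    (analyticAt_coeff_monicOfCoeffs n i (c 0)).fun_comp hc⟩

/-- Hensel's lemma for germs of analytic functions. -/
theorem IsAnalyticFamily.exists_mul_eq {E : Type*} [NormedAddCommGroup E] [NormedSpace ℝ E]
    {P : E → ℝ[X]} {m n : ℕ} (hP : IsAnalyticFamily P (m + n)) {q₁ q₂ : ℝ[X]} (h₁ : q₁.Monic)
    (h₂ : q₂.Monic) (hm : q₁.natDegree = m) (hn : q₂.natDegree = n) (hq : P 0 = q₁ * q₂)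
    (hc : IsCoprime q₁ q₂) :
    ∃ Q₁ Q₂ : E → ℝ[X], IsAnalyticFamily Q₁ m ∧ IsAnalyticFamily Q₂ n ∧
      ∀ᶠ v in 𝓝 0, P v = Q₁ v * Q₂ v := by
  set c : (Fin m → ℝ) × (Fin n → ℝ) := (fun i => q₁.coeff i, fun i => q₂.coeff i) with hcdef
  have e₁ : monicOfCoeffs m c.1 = q₁ := monicOfCoeffs_coeff h₁ hm
  have e₂ : monicOfCoeffs n c.2 = q₂ := monicOfCoeffs_coeff h₂ hn
  have hinj : Function.Injective (mulCoeffsDeriv m n c) :=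
    mulCoeffsDeriv_injective (by rwa [e₁, e₂])
  -- Source and target have the same dimension, so the injective derivative is invertible and the
  -- inverse function theorem applies.
  let L : ((Fin m → ℝ) × (Fin n → ℝ)) ≃L[ℝ] (Fin (m + n) → ℝ) :=
    (LinearEquiv.ofInjectiveOfFinrankEq (mulCoeffsDeriv m n c).toLinearMap hinj
      (by simp)).toContinuousLinearEquiv
  have hL : (L : ((Fin m → ℝ) × (Fin n → ℝ)) →L[ℝ] (Fin (m + n) → ℝ)) = mulCoeffsDeriv m n c := by
    ext <;> rfl
  -- Here `⊤` is the analytic smoothness class, so the local inverse is analytic.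
  have hcd : ContDiffAt ℝ ⊤ (mulCoeffs m n) c := (analyticAt_mulCoeffs m n c).contDiffAt
  have hfd : HasFDerivAt (mulCoeffs m n)
      (L : ((Fin m → ℝ) × (Fin n → ℝ)) →L[ℝ] (Fin (m + n) → ℝ)) c := by
    rw [hL]; exact hasFDerivAt_mulCoeffs m n c
  have hginv : ContDiffAt ℝ ⊤ (hcd.localInverse hfd (by simp)) (mulCoeffs m n c) :=
    hcd.to_localInverse hfd (by simp)
  have hright := (hcd.hasStrictFDerivAt' hfd (by simp)).eventually_right_inverse
  set g := hcd.localInverse hfd (by simp) with hg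
  set A : E → Fin (m + n) → ℝ := fun v k => (P v).coeff k with hA
  have hAan : AnalyticAt ℝ A 0 := by
    rw [analyticAt_pi_iff]
    exact fun k => hP.analyticAt_coeff k
  have hA0 : A 0 = mulCoeffs m n c := by
    ext k
    simp only [hA, mulCoeffs, e₁, e₂, hq]
  have hgan : AnalyticAt ℝ (fun v => g (A v)) 0 := by
    refine AnalyticAt.fun_comp ?_ hAan
    rw [hA0]
    exact hginv.analyticAt
  refine ⟨fun v => monicOfCoeffs m (g (A v)).1, fun v => monicOfCoeffs n (g (A v)).2,
    isAnalyticFamily_monicOfCoeffs (analyticAt_fst.fun_comp hgan),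
    isAnalyticFamily_monicOfCoeffs (analyticAt_snd.fun_comp hgan), ?_⟩
  have ht : Tendsto A (𝓝 0) (𝓝 (mulCoeffs m n c)) := hA0 ▸ hAan.continuousAt.tendsto
  filter_upwards [ht.eventually hright] with v hv
  replace hv : mulCoeffs m n (g (A v)) = A v := hv
  rw [← monicOfCoeffs_coeff (hP.monic v) (hP.natDegree_eq v),
    ← monicOfCoeffs_coeff ((monic_monicOfCoeffs (g (A v)).1).mul (monic_monicOfCoeffs (g (A v)).2))
    (n := m + n) (by rw [(monic_monicOfCoeffs _).natDegree_mul (monic_monicOfCoeffs _),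
      natDegree_monicOfCoeffs, natDegree_monicOfCoeffs])]
  exact congrArg _ hv.symm

/-! ### Exponents of monomials under inequalities. -/

theorem Filter.Eventually.exists_pos_forall_abs_lt {p : ℝ × ℝ → Prop} (h : ∀ᶠ v in 𝓝 0, p v) :
    ∃ ε > 0, ∀ x y : ℝ, |x| < ε → |y| < ε → p (x, y) := by
  obtain ⟨ε, hε, hp⟩ := Metric.eventually_nhds_iff_ball.1 h
  refine ⟨ε, hε, fun x y hx hy => hp _ ?_⟩
  rw [mem_ball_zero_iff, Prod.norm_mk]
  exact max_lt hx hy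

/-- If `k < k'`, division by `x ^ k` gives `a ≤ b * x ^ (k' - k)`, whose right side tends to zero.
-/
theorem le_of_eventually_pow_mul_le {k k' : ℕ} {a b : ℝ} (ha : 0 < a)
    (h : ∀ᶠ x in 𝓝[>] (0 : ℝ), x ^ k * a ≤ b * x ^ k') : k' ≤ k := by
  by_contra! hk
  have h1 : Tendsto (fun x : ℝ => b * x ^ (k' - k)) (𝓝[>] 0) (𝓝 0) := by
    refine Tendsto.mono_left (Continuous.tendsto' (by fun_prop) _ _ ?_) nhdsWithin_le_nhds
    simp [(Nat.sub_pos_of_lt hk).ne']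
  refine absurd (ge_of_tendsto h1 ?_) ha.not_ge
  filter_upwards [h, self_mem_nhdsWithin] with x hx hx0
  have hx0' : 0 < x ^ k := pow_pos hx0 _
  refine le_of_mul_le_mul_left (hx.trans (le_of_eq ?_)) hx0'
  rw [← Nat.sub_add_cancel hk.le, pow_add, Nat.add_sub_cancel]; ring

theorem eventually_half_abs_le {g : ℝ × ℝ → ℝ} (hg : ContinuousAt g 0) (h0 : g 0 ≠ 0) :
    ∀ᶠ v in 𝓝 0, |g 0| / 2 ≤ |g v| :=
  (hg.abs.eventually_const_lt (half_lt_self (abs_pos.2 h0))).mono fun _ => le_of_lt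

/-- Comparison of exponents of monomials. -/
theorem exponents_le_of_abs_le {k l k' l' : ℕ} {g : ℝ × ℝ → ℝ} {C : ℝ} (hg : ContinuousAt g 0)
    (h0 : g 0 ≠ 0) (h : ∀ᶠ v in 𝓝 (0 : ℝ × ℝ), v.1 ≠ 0 → v.2 ≠ 0 →
      |v.1 ^ k * v.2 ^ l * g v| ≤ C * |v.1 ^ k' * v.2 ^ l'|) : k' ≤ k ∧ l' ≤ l := by
  obtain ⟨ε, hε, H⟩ := (h.and (eventually_half_abs_le hg h0)).exists_pos_forall_abs_lt
  have hc : 0 < |g 0| / 2 := half_pos (abs_pos.2 h0)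
  have key : ∀ x y : ℝ, 0 < x → x < ε → 0 < y → y < ε →
      x ^ k * y ^ l * (|g 0| / 2) ≤ C * (x ^ k' * y ^ l') := by
    intro x y hx hx' hy hy'
    obtain ⟨h1, h2⟩ := H x y (by rwa [abs_of_pos hx]) (by rwa [abs_of_pos hy])
    have h3 := h1 hx.ne' hy.ne'
    rw [abs_mul, abs_of_pos (a := x ^ k * y ^ l) (by positivity),
      abs_of_pos (a := x ^ k' * y ^ l') (by positivity)] at h3
    exact (mul_le_mul_of_nonneg_left h2 (by positivity)).trans h3
  have hε2 : 0 < ε / 2 := half_pos hε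
  have hev : ∀ᶠ x in 𝓝[>] (0 : ℝ), 0 < x ∧ x < ε := Ioo_mem_nhdsGT hε
  -- One variable is frozen at `ε / 2` while the other tends to zero.
  constructor
  · refine le_of_eventually_pow_mul_le (a := (ε / 2) ^ l * (|g 0| / 2))
      (b := C * (ε / 2) ^ l') (by positivity) (hev.mono fun x hx => ?_)
    have := key x (ε / 2) hx.1 hx.2 hε2 (half_lt_self hε)
    linarith
  · refine le_of_eventually_pow_mul_le (a := (ε / 2) ^ k * (|g 0| / 2))
      (b := C * (ε / 2) ^ k') (by positivity) (hev.mono fun x hx => ?_)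
    have := key (ε / 2) x hε2 (half_lt_self hε) hx.1 hx.2
    linarith

/-- A monomial times a unit which is nonnegative off the axes has even exponents. -/
theorem even_exponents_of_nonneg {k l : ℕ} {g : ℝ × ℝ → ℝ} (hg : ContinuousAt g 0)
    (h0 : g 0 ≠ 0) (h : ∀ᶠ v in 𝓝 (0 : ℝ × ℝ), v.1 ≠ 0 → v.2 ≠ 0 →
      0 ≤ v.1 ^ k * v.2 ^ l * g v) : Even k ∧ Even l ∧ 0 < g 0 := by
  have hs : ∀ᶠ v in 𝓝 0, 0 < g v * g 0 :=
    (hg.mul continuousAt_const).eventually_const_lt (mul_self_pos.2 h0)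
  obtain ⟨ε, hε, H⟩ := (h.and hs).exists_pos_forall_abs_lt
  have hε2 : 0 < ε / 2 := half_pos hε
  have hlt : |ε / 2| < ε := by rw [abs_of_pos hε2]; exact half_lt_self hε
  have hlt' : |-(ε / 2)| < ε := by rwa [abs_neg]
  -- A point with positive coordinates fixes the sign of the unit; reversing the sign of one
  -- coordinate then tests the parity of its exponent.
  have hpos : 0 < g 0 := by
    obtain ⟨h1, h2⟩ := H _ _ hlt hlt
    have h3 := nonneg_of_mul_nonneg_right (h1 hε2.ne' hε2.ne') (by positivity)
    have h4 : 0 ≤ g (ε / 2, ε / 2) := h3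
    exact pos_of_mul_pos_right h2 h4
  have hgp : ∀ x y : ℝ, |x| < ε → |y| < ε → x ≠ 0 → y ≠ 0 → 0 ≤ x ^ k * y ^ l :=
    fun x y hx hy hx0 hy0 => nonneg_of_mul_nonneg_left ((H x y hx hy).1 hx0 hy0)
      (pos_of_mul_pos_left (H x y hx hy).2 hpos.le)
  refine ⟨?_, ?_, hpos⟩
  · by_contra hk
    rw [Nat.not_even_iff_odd] at hk
    have := hgp _ _ hlt' hlt (neg_ne_zero.2 hε2.ne') hε2.ne'
    rw [hk.neg_pow, neg_mul] at this
    have h5 : 0 < (ε / 2) ^ k * (ε / 2) ^ l := by positivity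
    linarith
  · by_contra hk
    rw [Nat.not_even_iff_odd] at hk
    have := hgp _ _ hlt hlt' hε2.ne' (neg_ne_zero.2 hε2.ne')
    rw [hk.neg_pow, mul_neg] at this
    have h5 : 0 < (ε / 2) ^ k * (ε / 2) ^ l := by positivity
    linarith

theorem IsMonomialGerm.eventually_eq_zero {f : ℝ × ℝ → ℝ} (hf : IsMonomialGerm f)
    (h : ∀ᶠ v in 𝓝 (0 : ℝ × ℝ), v.1 ≠ 0 → v.2 ≠ 0 → f v = 0) : ∀ᶠ v in 𝓝 0, f v = 0 := by
  refine hf.resolve_right ?_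
  rintro ⟨k, l, g, hg, h0, hev⟩
  obtain ⟨ε, hε, H⟩ := ((h.and hev).and
    (hg.continuousAt.eventually_ne h0)).exists_pos_forall_abs_lt
  have hε2 : 0 < ε / 2 := half_pos hε
  have hlt : |ε / 2| < ε := by rw [abs_of_pos hε2]; exact half_lt_self hε
  obtain ⟨⟨h1, h2⟩, h3⟩ := H _ _ hlt hlt
  rw [h1 hε2.ne' hε2.ne'] at h2
  have h4 : (ε / 2) ^ k * (ε / 2) ^ l ≠ 0 := by positivity
  exact mul_ne_zero h4 h3 h2.symm

/-! ### Families that split after a substitution. -/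

/-- The members of the family near the origin and off the axes are real-rooted. -/
def SplitsOffAxes (P : ℝ × ℝ → ℝ[X]) : Prop :=
  ∀ᶠ v in 𝓝 (0 : ℝ × ℝ), v.1 ≠ 0 → v.2 ≠ 0 → (P v).Splits

/-- The family splits analytically near the origin after some `blow N`. -/
def SplitsAfterBlow (P : ℝ × ℝ → ℝ[X]) (d : ℕ) : Prop :=
  ∃ (N : ℕ) (f : Fin d → ℝ × ℝ → ℝ), (∀ i, AnalyticAt ℝ (f i) 0) ∧
    ∀ᶠ v in 𝓝 0, P (blow N v) = ∏ i, (X - C (f i v))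

theorem SplitsOffAxes.comp_blow {P : ℝ × ℝ → ℝ[X]} (h : SplitsOffAxes P) (N : ℕ) :
    SplitsOffAxes fun v => P (blow N v) :=
  ((tendsto_blow N).eventually h).mono fun _ hv h1 h2 =>
    hv (mul_ne_zero (pow_ne_zero _ h2) h1) h2

/-- Allows two factors to be brought to a common exponent. -/
theorem SplitsAfterBlow.exists_ge {P : ℝ × ℝ → ℝ[X]} {d : ℕ} (h : SplitsAfterBlow P d) :
    ∃ N₀, ∀ N ≥ N₀, ∃ f : Fin d → ℝ × ℝ → ℝ, (∀ i, AnalyticAt ℝ (f i) 0) ∧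
      ∀ᶠ v in 𝓝 0, P (blow N v) = ∏ i, (X - C (f i v)) := by
  obtain ⟨N₀, f, hf, hev⟩ := h
  refine ⟨N₀, fun N hN => ⟨fun i v => f i (blow (N - N₀) v), fun i => (hf i).comp_blow _, ?_⟩⟩
  filter_upwards [(tendsto_blow (N - N₀)).eventually hev] with v hv
  rw [← hv, blow_blow, Nat.add_sub_cancel' hN]

theorem SplitsAfterBlow.mul {P Q₁ Q₂ : ℝ × ℝ → ℝ[X]} {m n : ℕ} (h₁ : SplitsAfterBlow Q₁ m)
    (h₂ : SplitsAfterBlow Q₂ n) (h : ∀ᶠ v in 𝓝 0, P v = Q₁ v * Q₂ v) :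
    SplitsAfterBlow P (m + n) := by
  obtain ⟨N₁, h₁⟩ := h₁.exists_ge
  obtain ⟨N₂, h₂⟩ := h₂.exists_ge
  obtain ⟨f₁, hf₁, he₁⟩ := h₁ (max N₁ N₂) (le_max_left _ _)
  obtain ⟨f₂, hf₂, he₂⟩ := h₂ (max N₁ N₂) (le_max_right _ _)
  refine ⟨max N₁ N₂, Fin.append f₁ f₂, fun i => ?_, ?_⟩
  · refine Fin.addCases (fun i => ?_) (fun i => ?_) i
    · rw [Fin.append_left]; exact hf₁ i
    · rw [Fin.append_right]; exact hf₂ i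
  · filter_upwards [(tendsto_blow (max N₁ N₂)).eventually h, he₁, he₂] with v h1 h2 h3
    simp [h1, h2, h3, Fin.prod_univ_add]

theorem SplitsAfterBlow.of_comp_blow {P : ℝ × ℝ → ℝ[X]} {d N : ℕ}
    (h : SplitsAfterBlow (fun v => P (blow N v)) d) : SplitsAfterBlow P d := by
  obtain ⟨M, f, hf, hev⟩ := h
  exact ⟨N + M, f, hf, hev.mono fun v hv => by rw [← hv]; simp only [blow_blow]⟩

theorem Polynomial.scaleRoots_prod_X_sub_C {ι : Type*} (s : Finset ι) (f : ι → ℝ) (w : ℝ) :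
    (∏ i ∈ s, (X - C (f i))).scaleRoots w = ∏ i ∈ s, (X - C (f i * w)) := by
  classical
  induction s using Finset.induction_on with
  | empty => simp
  | insert i s hi ih =>
    rw [Finset.prod_insert hi, Finset.prod_insert hi, mul_scaleRoots_of_noZeroDivisors, ih,
      X_sub_C_scaleRoots]

theorem SplitsAfterBlow.scaleRoots {P Q : ℝ × ℝ → ℝ[X]} {d : ℕ} {w : ℝ × ℝ → ℝ}
    (hQ : SplitsAfterBlow Q d) (hw : AnalyticAt ℝ w 0)
    (h : ∀ᶠ v in 𝓝 0, P v = (Q v).scaleRoots (w v)) : SplitsAfterBlow P d := by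
  obtain ⟨N, f, hf, hev⟩ := hQ
  refine ⟨N, fun i v => f i v * w (blow N v), fun i => (hf i).mul (hw.comp_blow N), ?_⟩
  filter_upwards [hev, (tendsto_blow N).eventually h] with v h1 h2
  rw [h2, h1, scaleRoots_prod_X_sub_C]

theorem SplitsAfterBlow.taylor {P Q : ℝ × ℝ → ℝ[X]} {d : ℕ} {c : ℝ × ℝ → ℝ}
    (hQ : SplitsAfterBlow Q d) (hc : AnalyticAt ℝ c 0)
    (h : ∀ᶠ v in 𝓝 0, P v = (Q v).taylor (c v)) : SplitsAfterBlow P d := by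
  obtain ⟨N, f, hf, hev⟩ := hQ
  refine ⟨N, fun i v => f i v - c (blow N v), fun i => (hf i).sub (hc.comp_blow N), ?_⟩
  filter_upwards [hev, (tendsto_blow N).eventually h] with v h1 h2
  rw [h2, h1, taylor_apply, prod_comp]
  refine Finset.prod_congr rfl fun i _ => ?_
  simp only [sub_comp, X_comp, C_comp, C_sub]; ring

theorem IsAnalyticFamily.continuousAt_aeval {P : ℝ × ℝ → ℝ[X]} {d : ℕ} (hP : IsAnalyticFamily P d)
    (z : ℂ) : ContinuousAt (fun v => aeval z (P v)) 0 := by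
  simp only [aeval_eq_sum_range, hP.natDegree_eq]
  refine tendsto_finsetSum _ fun i _ => ?_
  exact (hP.analyticAt_coeff i).continuousAt.smul continuousAt_const

/-- The bound `|z.im| ^ d ≤ ‖aeval z (P v)‖` passes to the limit along the diagonal, which meets the
axes only at the origin. -/
theorem IsAnalyticFamily.splits_zero {P : ℝ × ℝ → ℝ[X]} {d : ℕ} (hP : IsAnalyticFamily P d)
    (h : SplitsOffAxes P) : (P 0).Splits := by
  refine IsHyperbolic.splits fun z hz => ?_
  have hline : Tendsto (fun t : ℝ => ((t, t) : ℝ × ℝ)) (𝓝[≠] 0) (𝓝 0) :=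
    (Continuous.tendsto' (by fun_prop) _ _ rfl).mono_left nhdsWithin_le_nhds
  have h1 := ((hP.continuousAt_aeval z).norm.tendsto.comp hline)
  have h2 := ge_of_tendsto h1 (b := |z.im| ^ d) (by
    filter_upwards [hline.eventually h, self_mem_nhdsWithin] with t ht ht0
    rw [← hP.natDegree_eq (t, t)]
    exact (ht ht0 ht0).abs_im_pow_le_norm_aeval (hP.monic _) z)
  rw [hz, norm_zero] at h2
  by_contra hne
  exact h2.not_gt (pow_pos (abs_pos.2 hne) _)

theorem coeff_monicOfCoeffs_fin {n : ℕ} (c : Fin n → ℝ) (j : Fin n) :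
    (monicOfCoeffs n c).coeff j = c j := by
  have h : degreeLTEquiv ℝ n ((degreeLTEquiv ℝ n).symm c) j = c j := by simp
  rw [monicOfCoeffs, coeff_add, coeff_X_pow, if_neg j.2.ne, zero_add]
  exact h

theorem IsAnalyticFamily.comp_blow {P : ℝ × ℝ → ℝ[X]} {d : ℕ} (hP : IsAnalyticFamily P d) (N : ℕ) :
    IsAnalyticFamily (fun v => P (blow N v)) d :=
  ⟨fun _ => hP.monic _, fun _ => hP.natDegree_eq _, fun i => (hP.analyticAt_coeff i).comp_blow N⟩

theorem IsAnalyticFamily.exists_isMonomialGerm {P : ℝ × ℝ → ℝ[X]} {d : ℕ}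
    (hP : IsAnalyticFamily P d) :
    ∃ N, ∀ i < d, IsMonomialGerm fun v => (P (blow N v)).coeff i := by
  choose N hN using fun i => (hP.analyticAt_coeff i).exists_isMonomialGerm_blow
  exact ⟨(Finset.range d).sup N, fun i hi => hN i _ (Finset.le_sup (Finset.mem_range.2 hi))⟩

theorem IsAnalyticFamily.splitsAfterBlow_of_coeff_eq_zero {P : ℝ × ℝ → ℝ[X]} {d : ℕ}
    (hP : IsAnalyticFamily P d) (h : ∀ i < d, ∀ᶠ v in 𝓝 0, (P v).coeff i = 0) :
    SplitsAfterBlow P d := by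
  refine ⟨0, fun _ _ => 0, fun _ => analyticAt_const, ?_⟩
  have h' : ∀ᶠ v in 𝓝 0, ∀ i ∈ Finset.range d, (P v).coeff i = 0 :=
    (Finset.eventually_all _).2 fun i hi => h i (Finset.mem_range.1 hi)
  filter_upwards [(tendsto_blow 0).eventually h'] with v hv
  have h1 := monicOfCoeffs_coeff (hP.monic (blow 0 v)) (hP.natDegree_eq _)
  have h2 : (fun i : Fin d => (P (blow 0 v)).coeff i) = 0 := by
    ext i; exact hv i (Finset.mem_range.2 i.2)
  rw [← h1, h2]
  simp [monicOfCoeffs]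

theorem SplitsOffAxes.eventually_abs_coeff_le {P : ℝ × ℝ → ℝ[X]} {n : ℕ}
    (hP : IsAnalyticFamily P (n + 2)) (hs : SplitsOffAxes P) (hc : ∀ v, (P v).coeff (n + 1) = 0) :
    ∀ᶠ v in 𝓝 (0 : ℝ × ℝ), v.1 ≠ 0 → v.2 ≠ 0 → 0 ≤ -(P v).coeff n ∧ ∀ i,
      |(P v).coeff i| ≤ √(-2 * (P v).coeff n) ^ (n + 2 - i) * (n + 2).choose i :=
  hs.mono fun v hv h1 h2 => ⟨((hv h1 h2).sq_root_le (hP.monic v) (hP.natDegree_eq v) (hc v)).1,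
    fun i => (hv h1 h2).abs_coeff_le (hP.monic v) (hP.natDegree_eq v) (hc v) i⟩

/-! ### Dividing the roots by a monomial, and the induction on the degree. -/

/-- If the coefficients of a centered family are monomials times units, then its roots are divisible
by a monomial. -/
theorem IsAnalyticFamily.exists_eq_scaleRoots {P : ℝ × ℝ → ℝ[X]} {n : ℕ}
    (hP : IsAnalyticFamily P (n + 2)) (hs : SplitsOffAxes P) (hc : ∀ v, (P v).coeff (n + 1) = 0)
    (hm : ∀ i < n + 2, IsMonomialGerm fun v => (P v).coeff i) (hne : ¬∀ᶠ v in 𝓝 0, (P v).coeff n = 0) :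
    ∃ (w : ℝ × ℝ → ℝ) (Q : ℝ × ℝ → ℝ[X]), AnalyticAt ℝ w 0 ∧ IsAnalyticFamily Q (n + 2) ∧
      SplitsOffAxes Q ∧ (Q 0).coeff (n + 1) = 0 ∧ (Q 0).coeff n ≠ 0 ∧
      ∀ᶠ v in 𝓝 0, P v = (Q v).scaleRoots (w v) := by
  have hbound := hs.eventually_abs_coeff_le hP hc
  obtain ⟨k, l, g, hg, hg0, hgev⟩ := (hm n (by omega)).resolve_left hne
  obtain ⟨⟨k, rfl⟩, ⟨l, rfl⟩, hneg⟩ := even_exponents_of_nonneg (k := k) (l := l) hg.neg.continuousAt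
    (neg_ne_zero.2 hg0) (by
      filter_upwards [hbound, hgev] with v h1 h2 hx hy
      have := (h1 hx hy).1
      rw [h2] at this
      rw [Pi.neg_apply]; linarith)
  rw [Pi.neg_apply] at hneg
  set w : ℝ × ℝ → ℝ := fun v => v.1 ^ k * v.2 ^ l with hw
  set K : ℝ := √(2 * (-g 0 + 1)) with hK
  have hsqrt : ∀ᶠ v in 𝓝 0, √(-2 * (P v).coeff n) ≤ |w v| * K := by
    filter_upwards [hgev, hg.neg.continuousAt.eventually_lt_const
      (show (-g) 0 < -g 0 + 1 by rw [Pi.neg_apply]; linarith)] with v h1 h2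
    rw [h1, ← Real.sqrt_sq_eq_abs, hK, ← Real.sqrt_mul (sq_nonneg _)]
    refine Real.sqrt_le_sqrt ?_
    rw [Pi.neg_apply] at h2
    have : 0 ≤ (w v) ^ 2 * (-g 0 + 1 - -g v) := mul_nonneg (sq_nonneg _) (by linarith)
    simp only [hw] at this ⊢
    ring_nf at this ⊢
    linarith
  -- The `b j` are the coefficients of the family with roots divided by `w`. For `j = n` the divisor
  -- is `w ^ 2`, exactly the monomial of that coefficient, so the unit `g` remains.
  have hb : ∀ j : Fin (n + 2), ∃ b : ℝ × ℝ → ℝ, AnalyticAt ℝ b 0 ∧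
      (∀ᶠ v in 𝓝 0, (P v).coeff j = b v * w v ^ (n + 2 - j)) ∧
      ((j : ℕ) = n → b 0 ≠ 0) ∧ ((j : ℕ) = n + 1 → b 0 = 0) := by
    rintro ⟨j, hj⟩
    by_cases hjn : j = n
    · subst hjn
      refine ⟨g, hg, hgev.mono fun v hv => ?_, fun _ => hg0, fun h => by simp at h⟩
      simp only [hv, hw, Nat.add_sub_cancel_left]
      ring
    by_cases hj1 : j = n + 1
    · subst hj1
      exact ⟨0, analyticAt_const, Eventually.of_forall fun v => by simpa using hc v,
        fun h => (hjn h).elim, fun _ => rfl⟩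
    rcases hm j hj with h0 | ⟨k', l', h, hh, hh0, hev⟩
    · exact ⟨0, analyticAt_const, h0.mono fun v hv => by simpa using hv, fun h => (hjn h).elim,
        fun _ => rfl⟩
    have hle := exponents_le_of_abs_le (k := k') (l := l') (k' := k * (n + 2 - j))
      (l' := l * (n + 2 - j)) (C := K ^ (n + 2 - j) * (n + 2).choose j) hh.continuousAt hh0 (by
        filter_upwards [hbound, hev, hsqrt] with v h1 h2 h3 hx hy
        rw [← h2]
        refine ((h1 hx hy).2 j).trans ?_
        have h4 : √(-2 * (P v).coeff n) ^ (n + 2 - j) ≤ (|w v| * K) ^ (n + 2 - j) := by gcongr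
        refine (mul_le_mul_of_nonneg_right h4 (by positivity)).trans (le_of_eq ?_)
        rw [pow_mul, pow_mul, ← mul_pow, abs_pow]
        ring)
    refine ⟨fun v => v.1 ^ (k' - k * (n + 2 - j)) * v.2 ^ (l' - l * (n + 2 - j)) * h v,
      ((analyticAt_fst.pow _).mul (analyticAt_snd.pow _)).mul hh, hev.mono fun v hv => ?_,
      fun h => (hjn h).elim, fun h => (hj1 h).elim⟩
    refine hv.trans ?_
    simp only [hw, mul_pow, ← pow_mul]
    conv_lhs => rw [← Nat.sub_add_cancel hle.1, ← Nat.sub_add_cancel hle.2, pow_add, pow_add]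
    ring
  choose b hban hbev hbn hbn1 using hb
  have hQ : IsAnalyticFamily (fun v => monicOfCoeffs (n + 2) fun j => b j v) (n + 2) :=
    isAnalyticFamily_monicOfCoeffs (analyticAt_pi_iff.2 hban)
  have hPQ : ∀ᶠ v in 𝓝 0,
      P v = (monicOfCoeffs (n + 2) fun j => b j v).scaleRoots (w v) := by
    filter_upwards [eventually_all.2 hbev] with v hv
    have hQm := monic_monicOfCoeffs fun j => b j v
    rw [← monicOfCoeffs_coeff (hP.monic v) (hP.natDegree_eq v), ← monicOfCoeffs_coeff
      ((monic_scaleRoots_iff (w v)).2 hQm) (n := n + 2)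
      (by rw [natDegree_scaleRoots, natDegree_monicOfCoeffs])]
    congr 1
    ext j
    rw [coeff_scaleRoots, natDegree_monicOfCoeffs, coeff_monicOfCoeffs_fin, hv j]
  refine ⟨w, _, (analyticAt_fst.pow _).mul (analyticAt_snd.pow _), hQ, ?_, ?_, ?_, hPQ⟩
  · filter_upwards [hs, hPQ] with v h1 h2 hx hy
    -- Off the axes `w v ≠ 0`, so the scaling can be undone.
    have h3 := (h1 hx hy).scaleRoots (w v)⁻¹
    have hw0 : w v ≠ 0 := mul_ne_zero (pow_ne_zero _ hx) (pow_ne_zero _ hy)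
    rwa [h2, ← scaleRoots_mul, mul_inv_cancel₀ hw0, scaleRoots_one] at h3
  · exact (coeff_monicOfCoeffs_fin _ ⟨n + 1, by omega⟩).trans (hbn1 ⟨n + 1, by omega⟩ rfl)
  · exact (coeff_monicOfCoeffs_fin (fun j => b j 0) ⟨n, by omega⟩).trans_ne
      (hbn ⟨n, by omega⟩ rfl)

/-- A centered real-rooted polynomial with two distinct roots is a product of coprime factors. -/
theorem Polynomial.Splits.exists_coprime_factors {q : ℝ[X]} {n : ℕ} (hq : q.Splits) (hm : q.Monic)
    (hd : q.natDegree = n + 2) (h1 : q.coeff (n + 1) = 0) (h0 : q.coeff n ≠ 0) :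
    ∃ q₁ q₂ : ℝ[X], q₁.Monic ∧ q₂.Monic ∧ 0 < q₁.natDegree ∧ 0 < q₂.natDegree ∧ q = q₁ * q₂ ∧
      IsCoprime q₁ q₂ := by
  obtain ⟨r, hr⟩ := hq.exists_eval_eq_zero (by
    rw [degree_eq_natDegree hm.ne_zero, hd]; exact_mod_cast (n + 1).succ_ne_zero)
  -- One factor collects the full multiplicity of `r`. If nothing else were left, `q = (X - C r) ^
  -- (n + 2)`; centering forces `r = 0`, against `h0`.
  obtain ⟨s, hs, hnd⟩ := q.exists_eq_pow_rootMultiplicity_mul_and_not_dvd hm.ne_zero r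
  have hpow : ((X - C r) ^ q.rootMultiplicity r).Monic := (monic_X_sub_C r).pow _
  have hsm : s.Monic := hpow.of_mul_monic_left (hs ▸ hm)
  refine ⟨_, s, hpow, hsm, ?_, ?_, hs, ?_⟩
  · rw [natDegree_pow, natDegree_X_sub_C, mul_one]
    exact (rootMultiplicity_pos hm.ne_zero).2 hr
  · by_contra! hs0
    rw [hsm.natDegree_eq_zero.1 (by omega), mul_one] at hs
    have hmul : q.rootMultiplicity r = n + 2 := by
      rw [← hd]; conv_rhs => rw [hs, natDegree_pow, natDegree_X_sub_C, mul_one]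
    rw [hmul] at hs
    rw [hs, sub_eq_add_neg, ← C_neg, coeff_X_add_C_pow] at h1 h0
    have hr0 : r = 0 := by
      rw [show n + 2 - (n + 1) = 1 by omega, pow_one] at h1
      have : ((n + 2).choose (n + 1) : ℝ) ≠ 0 := by
        exact_mod_cast (Nat.choose_pos (by omega)).ne'
      exact neg_eq_zero.1 ((mul_eq_zero.1 h1).resolve_right this)
    exact h0 (by rw [hr0]; simp [show n + 2 - n = 2 by omega])
  · exact (((irreducible_X_sub_C r).coprime_iff_not_dvd).2 hnd).pow_left

theorem IsAnalyticFamily.taylor {P : ℝ × ℝ → ℝ[X]} {d : ℕ} (hP : IsAnalyticFamily P d)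
    {c : ℝ × ℝ → ℝ} (hc : AnalyticAt ℝ c 0) : IsAnalyticFamily (fun v => taylor (c v) (P v)) d := by
  refine ⟨fun v => ?_, fun v => by rw [natDegree_taylor, hP.natDegree_eq], fun i => ?_⟩
  · rw [Monic, leadingCoeff_taylor]; exact hP.monic v
  · have h : ∀ v, (Polynomial.taylor (c v) (P v)).coeff i
        = ∑ j ∈ Finset.range (d + 1), (j.choose i : ℝ) * (P v).coeff j * c v ^ (j - i) := by
      intro v
      rw [taylor_coeff, hasseDeriv_apply, sum_over_range' _ (by simp) (d + 1)
        (by rw [hP.natDegree_eq]; omega), eval_finsetSum]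
      simp [eval_monomial]
    simp only [h]
    exact Finset.analyticAt_fun_sum _ fun j _ =>
      (analyticAt_const.mul (hP.analyticAt_coeff j)).mul (hc.pow _)

/-- Translation by `t` adds `(n + 1) * t` to this coefficient. -/
theorem Polynomial.Monic.coeff_taylor_neg_div {p : ℝ[X]} {n : ℕ} (hp : p.Monic)
    (hd : p.natDegree = n + 1) : (taylor (-(p.coeff n / (n + 1))) p).coeff n = 0 := by
  rw [taylor_coeff, hasseDeriv_apply, sum_over_range' _ (by simp) (n + 2)
    (by rw [hd]; omega), eval_finsetSum, Finset.sum_range_succ, Finset.sum_range_succ,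
    Finset.sum_eq_zero]
  · have h1 : p.coeff (n + 1) = 1 := by rw [← hd]; exact hp.coeff_natDegree
    have : (n : ℝ) + 1 ≠ 0 := by positivity
    simp [h1, eval_monomial]
    field_simp
    ring
  · intro j hj
    simp [Nat.choose_eq_zero_of_lt (Finset.mem_range.1 hj)]

/-- An analytic family of real-rooted polynomials splits analytically after some `blow N`. -/
theorem IsAnalyticFamily.splitsAfterBlow {P : ℝ × ℝ → ℝ[X]} {d : ℕ} (hP : IsAnalyticFamily P d)
    (hs : SplitsOffAxes P) : SplitsAfterBlow P d := by
  induction d using Nat.strong_induction_on generalizing P with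
  | _ d ih =>
  obtain rfl | ⟨m, rfl⟩ : d = 0 ∨ ∃ m, d = m + 1 := by cases d <;> simp
  · exact hP.splitsAfterBlow_of_coeff_eq_zero (by simp)
  set c : ℝ × ℝ → ℝ := fun v => (P v).coeff m / (m + 1) with hc
  have hcan : AnalyticAt ℝ c 0 := (hP.analyticAt_coeff m).div_const
  set R : ℝ × ℝ → ℝ[X] := fun v => Polynomial.taylor (-c v) (P v) with hR
  have hRf : IsAnalyticFamily R (m + 1) := hP.taylor hcan.neg
  have hRs : SplitsOffAxes R := hs.mono fun v hv hx hy => (hv hx hy).taylor _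
  have hRc : ∀ v, (R v).coeff m = 0 := fun v =>
    (hP.monic v).coeff_taylor_neg_div (hP.natDegree_eq v)
  suffices h : SplitsAfterBlow R (m + 1) from
    h.taylor hcan (Eventually.of_forall fun v => by simp [hR, taylor_taylor])
  obtain rfl | ⟨n, rfl⟩ : m = 0 ∨ ∃ n, m = n + 1 := by cases m <;> simp
  · refine hRf.splitsAfterBlow_of_coeff_eq_zero fun i hi => Eventually.of_forall fun v => ?_
    rw [show i = 0 by omega]; exact hRc v
  obtain ⟨N, hN⟩ := hRf.exists_isMonomialGerm
  refine SplitsAfterBlow.of_comp_blow (N := N) ?_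
  have hSf := hRf.comp_blow N
  have hSs := hRs.comp_blow N
  have hSc : ∀ v, (R (blow N v)).coeff (n + 1) = 0 := fun v => hRc _
  -- When this coefficient vanishes, the bounds kill all lower coefficients off the axes, hence near
  -- the origin, since they are monomial germs.
  by_cases hne : ∀ᶠ v in 𝓝 0, (R (blow N v)).coeff n = 0
  · refine hSf.splitsAfterBlow_of_coeff_eq_zero fun i hi => (hN i hi).eventually_eq_zero ?_
    filter_upwards [hSs.eventually_abs_coeff_le hSf hSc, hne] with v h1 h2 hx hy
    have h3 := (h1 hx hy).2 i
    rw [h2, mul_zero, Real.sqrt_zero, zero_pow (by omega), zero_mul] at h3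
    exact abs_nonpos_iff.1 h3
  obtain ⟨w, Q, hw, hQf, hQs, hQ1, hQ0, hev⟩ := hSf.exists_eq_scaleRoots hSs hSc hN hne
  refine SplitsAfterBlow.scaleRoots ?_ hw hev
  obtain ⟨q₁, q₂, hm₁, hm₂, hd₁, hd₂, hq, hcop⟩ := (hQf.splits_zero hQs).exists_coprime_factors
    (hQf.monic 0) (hQf.natDegree_eq 0) hQ1 hQ0
  have hdeg : n + 1 + 1 = q₁.natDegree + q₂.natDegree := by
    rw [← hm₁.natDegree_mul hm₂, ← hq, hQf.natDegree_eq]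
  rw [hdeg] at hQf ih ⊢
  obtain ⟨Q₁, Q₂, hQ₁, hQ₂, hmul⟩ := hQf.exists_mul_eq hm₁ hm₂ rfl rfl hq hcop
  have hs₁ : SplitsOffAxes Q₁ := by
    filter_upwards [hQs, hmul] with v h1 h2 hx hy
    exact (h1 hx hy).of_dvd (hQf.monic v).ne_zero ⟨_, h2⟩
  have hs₂ : SplitsOffAxes Q₂ := by
    filter_upwards [hQs, hmul] with v h1 h2 hx hy
    exact (h1 hx hy).of_dvd (hQf.monic v).ne_zero ⟨_, by rw [h2, mul_comm]⟩
  exact (ih _ (by omega) hQ₁ hs₁).mul (ih _ (by omega) hQ₂ hs₂) hmul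

/-! ### Back to the horn region. -/

theorem isAnalyticFamily_monicFamily {d : ℕ} {a : Fin d → ℝ × ℝ → ℝ}
    (ha : ∀ i, AnalyticAt ℝ (a i) 0) : IsAnalyticFamily (monicFamily a) d := by
  have hlt : ∀ p, (∑ i : Fin d, C (a i p) * X ^ (d - ((i : ℕ) + 1))).degree < (d : WithBot ℕ) := by
    intro p
    rw [← mem_degreeLT]
    refine Submodule.sum_mem _ fun i _ => mem_degreeLT.2 ((degree_C_mul_X_pow_le _ _).trans_lt ?_)
    exact_mod_cast Nat.sub_lt (Nat.zero_lt_of_lt i.2) (Nat.succ_pos _)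
  refine ⟨fun p => monic_X_pow_add (hlt p), fun p => ?_, fun j => ?_⟩
  · refine natDegree_eq_of_degree_eq_some ?_
    rw [monicFamily, degree_add_eq_left_of_degree_lt (by simpa using hlt p), degree_X_pow]
  · simp only [monicFamily, coeff_add, finsetSum_coeff, coeff_C_mul]
    exact analyticAt_const.add (Finset.analyticAt_fun_sum _ fun i _ =>
      (ha i).mul analyticAt_const)

theorem proposition3p5 (d : ℕ) (U : Set (ℝ × ℝ)) (hU : IsOpen U) (h0 : (0, 0) ∈ U)
    (a : Fin d → ℝ × ℝ → ℝ) (ha : ∀ i, AnalyticOnNhd ℝ (a i) U)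
    (hyp : ∀ p ∈ U, IsHyperbolic (monicFamily a p)) :
    ∃ (N₀ : ℕ) (δ₀ : ℝ), 0 < δ₀ ∧
      ∀ (N : ℕ) (δ : ℝ), N₀ ≤ N → 0 < δ → δ ≤ δ₀ →
        hornRegion N δ ⊆ U ∧
        ∃ f : Fin d → ℝ × ℝ → ℝ,
          (∀ i, AnalyticOnNhd ℝ (f i) (hornRegion N δ)) ∧
          ∀ p ∈ hornRegion N δ, ∀ z : ℝ,
            (monicFamily a p).eval z = ∏ i : Fin d, (z - f i p) := by
  have hU0 : U ∈ 𝓝 (0 : ℝ × ℝ) := hU.mem_nhds h0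
  have hs : SplitsOffAxes (monicFamily a) := by
    filter_upwards [hU0] with p hp _ _ using (hyp p hp).splits
  obtain ⟨M, f, hf, hev⟩ := (isAnalyticFamily_monicFamily fun i => ha i _ h0).splitsAfterBlow hs
  obtain ⟨ε, hε, H⟩ := ((show ∀ᶠ p in 𝓝 (0 : ℝ × ℝ), p ∈ U from hU0).and
    ((eventually_all.2 fun i => (hf i).eventually_analyticAt).and hev)).exists_pos_forall_abs_lt
  -- The extra power gives `|x / y ^ M| < y < ε`; the bound `1` makes powers of `y` decrease with
  -- the exponent.
  refine ⟨M + 1, min ε 1, lt_min hε one_pos, fun N δ hN hδ hδ' => ?_⟩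
  have key : ∀ p ∈ hornRegion N δ, 0 < p.2 ∧ |p.2| < ε ∧ |p.1| < ε ∧ |p.1 / p.2 ^ M| < ε := by
    rintro ⟨x, y⟩ ⟨hx, hy, hyδ⟩
    simp only at hx hy hyδ ⊢
    have hy1 : y ≤ 1 := (hyδ.le.trans hδ').trans (min_le_right _ _)
    have hyε : y < ε := hyδ.trans_le (hδ'.trans (min_le_left _ _))
    have hyM : 0 < y ^ M := pow_pos hy _
    have h1 : |x| < y * y ^ M := by
      rw [← pow_succ']
      exact hx.trans_le (pow_le_pow_of_le_one hy.le hy1 hN)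
    refine ⟨hy, by rwa [abs_of_pos hy], ?_, ?_⟩
    · exact h1.trans_le ((mul_le_of_le_one_right hy.le (pow_le_one₀ hy.le hy1)).trans hyε.le)
    · rw [abs_div, abs_of_pos hyM, div_lt_iff₀ hyM]
      exact h1.trans (mul_lt_mul_of_pos_right hyε hyM)
  refine ⟨fun p hp => (H p.1 p.2 (key p hp).2.2.1 (key p hp).2.1).1,
    fun i p => f i (p.1 / p.2 ^ M, p.2), fun i p hp => ?_, fun p hp z => ?_⟩
  · obtain ⟨hy, hyε, -, hu⟩ := key p hp
    exact ((H _ _ hu hyε).2.1 i).fun_comp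
      (f := fun p : ℝ × ℝ => (p.1 / p.2 ^ M, p.2)) ((analyticAt_fst.fun_div (analyticAt_snd.fun_pow M)
      (pow_ne_zero _ hy.ne')).prod analyticAt_snd)
  · obtain ⟨hy, hyε, -, hu⟩ := key p hp
    have h1 := (H _ _ hu hyε).2.2
    have h2 : blow M (p.1 / p.2 ^ M, p.2) = p := by
      ext
      · exact mul_div_cancel₀ _ (pow_ne_zero _ hy.ne')
      · rfl
    rw [h2] at h1
    rw [h1, eval_prod]
    simp
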